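/- All rings are commutative with identity. Let $A$ be a local ring (not necessarily Noetherian) with unique maximal ideal $m$, and assume that $m$ is finitely generated. Let $(A/m)^{(I)}$ be the direct sum of copies of $A/m$ indexed by an infinite set $I$, and let $R = A \ltimes (A/m)^{(I)}$ be the trivial ring extension, i.e. the additive group $A \times (A/m)^{(I)}$ with multiplication $(a,e)(a',e') = (aa', ae' + a'e)$. An $R$-module $M$ is called strongly Gorenstein projective if there are a projective $R$-module $P$ and an $R$-linear map $f : P \to P$ such that $M \cong \operatorname{Im} f$ and the sequence $\cdots \xrightarrow{f} P \xrightarrow{f} P \xrightarrow{f} P \xrightarrow{f} \cdots$ is exact and remains exact after applying $\operatorname{Hom}_R(-,Q)$ for every projective $R$-module $Q$. The weak global dimension $\operatorname{wdim}(R)$ is the supremum of the flat dimensions of all $R$-modules. Then: 1. $\operatorname{wdim}(R) = \infty$; 2. every finitely generated strongly Gorenstein projective $R$-module is projective; 3. no nonzero finitely generated proper ideal of $R$ is strongly Gorenstein projective. -/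

import Mathlib

universe u v w

/-- `HasFlatDimLE R n M`: the `R`-module `M` has flat dimension at most `n`, i.e. there is an exact
sequence `0 → Fₙ → ⋯ → F₁ → F₀ → M → 0` with all `Fᵢ` flat. The sequence is built one step at a
time: `F₀ → M` is surjective and its kernel has such a resolution of length `n - 1`. -/
def HasFlatDimLE (R : Type u) [CommRing R] :
    ℕ → ∀ (M : Type (max u v)) [AddCommGroup M] [Module R M], Prop
  | 0, M, _, _ => Module.Flat R M
  | n + 1, M, _, _ =>
    ∃ (F : Type (max u v)) (_ : AddCommGroup F) (_ : Module R F) (g : F →ₗ[R] M),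
      Module.Flat R F ∧ Function.Surjective g ∧
        HasFlatDimLE R n (LinearMap.ker g)

/-- The flat (weak) dimension of a module, `⊤` if there is no finite flat resolution. -/
noncomputable def flatDim (R : Type u) [CommRing R]
    (M : Type (max u v)) [AddCommGroup M] [Module R M] : ℕ∞ :=
  ⨅ (n : ℕ) (_ : HasFlatDimLE.{u, v} R n M), (n : ℕ∞)

/-- The weak global dimension of `R`: the supremum of the flat dimensions of all `R`-modules. -/
noncomputable def weakGlobalDim (R : Type u) [CommRing R] : ℕ∞ :=
  ⨆ M : ModuleCat.{u} R, flatDim.{u, u} R M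

/-- `⋯ → P → P → P → ⋯` with all differentials equal to `f` is a complete projective resolution:
`P` is projective, the sequence is exact, and it stays exact after applying `Hom_R(-, Q)` for every
projective module `Q`. -/
structure IsCompleteProjectiveResolution (R : Type u) [CommRing R]
    (P : Type (max u v)) [AddCommGroup P] [Module R P] (f : P →ₗ[R] P) : Prop where
  projective : Module.Projective R P
  exact : Function.Exact f f
  hom_exact : ∀ (Q : Type (max u v)) [AddCommGroup Q] [Module R Q], Module.Projective R Q →
    Function.Exact (fun φ : P →ₗ[R] Q => φ ∘ₗ f) (fun φ : P →ₗ[R] Q => φ ∘ₗ f)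

/-- `M` is strongly Gorenstein projective: `M ≅ Im f` for some complete projective resolution
`⋯ → P → P → P → ⋯` all of whose differentials are equal to `f`. -/
def IsStronglyGorensteinProjective (R : Type u) [CommRing R]
    (M : Type v) [AddCommGroup M] [Module R M] : Prop :=
  ∃ (P : Type (max u v)) (_ : AddCommGroup P) (_ : Module R P) (f : P →ₗ[R] P),
    IsCompleteProjectiveResolution.{u, v} R P f ∧ Nonempty (M ≃ₗ[R] LinearMap.range f)

/-- The trivial ring extension `A ⋉ (A/m)^(ι)` of a local ring `(A, m)`, where `(A/m)^(ι)` is the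
direct sum of copies of `A/m` indexed by `ι`. -/
abbrev ResidueTrivialExt (A : Type u) [CommRing A] [IsLocalRing A] (ι : Type w) :
    Type (max u w) :=
  TrivSqZeroExt A (ι →₀ A ⧸ IsLocalRing.maximalIdeal A)

/-! Let `n` be the maximal ideal of `R` and `E` the square-zero copy of `(A/m)^(ι)`; then `nE = 0`.
Weak dimension: for a coordinate vector `e` of `E`, the annihilator of `e` is `n = Re ⊕ J`.
Dimension shifting shows that in a module of finite flat dimension everything killed by `e` lies in
`n` times the module; the class of `1` in `R/n` violates this. Projectivity: if `Im f` were not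
free, some `f x` in `nP` would lie outside `n · Im f`. Then `E` kills `f x`, so `Ex ⊆ Im f`, and a
suitable functional on `P` traps `E` in a finitely generated proper ideal, impossible for infinite
`ι`. Ideals: a nonzero free ideal is faithful, but `E` kills every proper ideal. -/

section ProjectiveCover

open IsLocalRing

/-- Over a local ring whose maximal ideal annihilates an ideal `E` that is not contained in any
finitely generated proper ideal, the finitely generated image of a square-zero exact endomorphism
of a projective module is free. -/
theorem Module.Free.range_of_exact_self {R : Type*} [CommRing R] [IsLocalRing R]
    (E : Ideal R) (hE : ∀ e ∈ E, ∀ x ∈ maximalIdeal R, e * x = 0)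
    (hfg : ∀ J : Ideal R, J.FG → J ≤ maximalIdeal R → ¬ E ≤ J)
    {P : Type*} [AddCommGroup P] [Module R P] [Module.Projective R P] (f : P →ₗ[R] P)
    (hf : Function.Exact f f) [Module.Finite R (LinearMap.range f)] :
    Module.Free R (LinearMap.range f) := by
  have hff (y : P) : f (f y) = 0 := (hf (f y)).2 ⟨y, rfl⟩
  have hN : (LinearMap.range f).FG := Module.Finite.iff_fg.1 inferInstance
  have hP : Module.Finite R P := by
    refine ⟨Submodule.fg_of_fg_map_of_fg_inf_ker f ?_ ?_⟩
    · rwa [Submodule.map_top]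
    · rwa [top_inf_eq, hf.linearMap_ker_eq]
  have hfree : Module.Free R P := Module.free_of_flat_of_isLocalRing
  refine Module.free_of_lTensor_residueField_injective (LinearMap.range f).subtype f.rangeRestrict
    f.surjective_rangeRestrict ?_ ?_
  · rw [LinearMap.exact_iff, LinearMap.ker_rangeRestrict, Submodule.range_subtype,
      hf.linearMap_ker_eq]
  rw [injective_iff_map_eq_zero]
  intro t ht
  obtain ⟨m, rfl⟩ : ∃ m : LinearMap.range f, (1 : ResidueField R) ⊗ₜ[R] m = t :=
    TensorProduct.mk_surjective R (LinearMap.range f) (ResidueField R) residue_surjective t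
  obtain ⟨_, x, rfl⟩ := m
  -- Multiplication by `e` factors through the residue field as `θ`; tensoring `θ` with `P` carries
  -- `1 ⊗ f x = 0` to `e • f x = 0`.
  have hsmul (e : R) (he : e ∈ E) : e • f x = 0 := by
    let θ : ResidueField R →ₗ[R] R :=
      Submodule.liftQ (maximalIdeal R) (LinearMap.toSpanSingleton R R e) fun a ha ↦ by
        simp [mul_comm a e, hE e he a ha]
    have hθ : θ 1 = e := by
      change Submodule.liftQ (maximalIdeal R) (LinearMap.toSpanSingleton R R e) _
        (Submodule.Quotient.mk 1) = e
      rw [Submodule.liftQ_apply, LinearMap.toSpanSingleton_apply, one_smul]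
    have := congrArg (fun z ↦ TensorProduct.lid R P (θ.rTensor P z)) ht
    simpa [hθ] using this
  by_contra hne
  obtain ⟨g, hg⟩ : ∃ g : Module.Dual (ResidueField R)
      (TensorProduct R (ResidueField R) (LinearMap.range f)),
      g (1 ⊗ₜ[R] ⟨f x, x, rfl⟩) ≠ 0 := by
    by_contra! h
    exact hne ((Module.forall_dual_apply_eq_zero_iff (ResidueField R) _).1 h)
  let ψ : P →ₗ[R] ResidueField R :=
    g.restrictScalars R ∘ₗ TensorProduct.mk R (ResidueField R) (LinearMap.range f) 1 ∘ₗ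
      f.rangeRestrict
  obtain ⟨φ, hφ⟩ := Module.projective_lifting_property
    (Algebra.linearMap R (ResidueField R)) ψ residue_surjective
  have hφ' (p : P) : residue R (φ p) = g (1 ⊗ₜ[R] f.rangeRestrict p) := LinearMap.congr_fun hφ p
  have hunit : IsUnit (φ x) := by
    rw [← residue_ne_zero_iff_isUnit, hφ']
    exact hg
  -- The image of `Im f` under `φ` is proper because `f ∘ f = 0`, and it contains `E` because `φ x`
  -- is a unit.
  refine hfg ((LinearMap.range f).map φ) (hN.map φ) ?_ fun e he ↦ ?_
  · rintro _ ⟨_, ⟨y, rfl⟩, rfl⟩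
    rw [← residue_eq_zero_iff, hφ',
      show f.rangeRestrict (f y) = 0 from Subtype.ext (hff y), TensorProduct.tmul_zero, map_zero]
  · have h1 : e • x ∈ LinearMap.range f := (hf (e • x)).1 (by rw [map_smul, hsmul e he])
    have h2 : e * φ x ∈ (LinearMap.range f).map φ := ⟨e • x, h1, by simp⟩
    exact (Ideal.mul_unit_mem_iff_mem _ hunit).1 h2

end ProjectiveCover

section FlatDimension

variable {R : Type u} [CommRing R]

/-- By the equational criterion, the relation `e x = ∑ cᵢ mᵢ` with `cᵢ ∈ J` is trivial: `x = ∑ aⱼ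
yⱼ` with every `aⱼ e ∈ J`. -/
theorem Module.Flat.mem_smul_top_of_smul_mem {M : Type*} [AddCommGroup M] [Module R M]
    [Module.Flat R M] {e : R} {J n : Ideal R} (hann : ∀ a, a * e ∈ J → a ∈ n) {x : M}
    (hx : e • x ∈ J • (⊤ : Submodule R M)) : x ∈ n • (⊤ : Submodule R M) := by
  obtain ⟨c, hc, hsum⟩ := (Submodule.mem_ideal_smul_span_iff_exists_sum J (id : M → M) (e • x)).1
    (by simpa using hx)
  let v : Option c.support → R := fun o ↦ o.elim (-e) fun i ↦ c i
  let w : Option c.support → M := fun o ↦ o.elim x fun i ↦ i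
  have hvw : ∑ o, v o • w o = 0 := by
    rw [Fintype.sum_option]
    simp only [v, w, Option.elim, neg_smul]
    rw [← hsum, Finsupp.sum, ← Finset.sum_coe_sort]
    simp
  obtain ⟨k, a, y, hw, hv⟩ := Module.Flat.isTrivialRelation_of_sum_smul_eq_zero hvw
  have hx' : x = ∑ j, a none j • y j := hw none
  rw [hx']
  refine Submodule.sum_mem _ fun j _ ↦ Submodule.smul_mem_smul (hann _ ?_) trivial
  have := hv j
  rw [Fintype.sum_option] at this
  simp only [v, Option.elim] at this
  rw [show a none j * e = ∑ i : c.support, c i * a (some i) j by linear_combination -this]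
  exact Submodule.sum_mem _ fun i _ ↦ J.mul_mem_right _ (hc i)

/-- If the annihilator `n` of `e` contains `e` and splits as `Re ⊕ J`, then the annihilator of `e`
in any module `M` of finite flat dimension is `nM`. -/
theorem HasFlatDimLE.mem_smul_top_of_smul_eq_zero {e : R} {J n : Ideal R}
    (hen : e ∈ n) (hne : ∀ a ∈ n, a * e = 0) (hn : n ≤ Ideal.span {e} ⊔ J)
    (hann : ∀ a, a * e ∈ J → a ∈ n) (d : ℕ) :
    ∀ (M : Type (max u v)) [AddCommGroup M] [Module R M], HasFlatDimLE.{u, v} R d M →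
      ∀ x : M, e • x = 0 → x ∈ n • (⊤ : Submodule R M) := by
  induction d with
  | zero =>
    intro M _ _ hM x hx
    have : Module.Flat R M := hM
    exact Module.Flat.mem_smul_top_of_smul_mem hann (hx ▸ zero_mem (J • (⊤ : Submodule R M)))
  | succ d ih =>
    rintro M _ _ ⟨F, _, _, g, hF, hg, hL⟩ x hx
    obtain ⟨y, rfl⟩ := hg x
    have hy : e • y ∈ LinearMap.ker g := by simpa using hx
    -- Since `e² = 0`, induction applies to `e y` in the kernel `L`: `e y = e l + t` with `l ∈ L`
    -- and `t ∈ JL`. Replacing `y` by `y - l` keeps its image and puts `e (y - l)` in `JF`.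
    have hey : (⟨e • y, hy⟩ : LinearMap.ker g) ∈ n • (⊤ : Submodule R (LinearMap.ker g)) :=
      ih _ hL _ (Subtype.ext (by simp [smul_smul, hne e hen]))
    replace hey := Submodule.smul_mono_left hn hey
    rw [Submodule.sup_smul, Submodule.mem_sup] at hey
    obtain ⟨s, hs, t, ht, hst⟩ := hey
    rw [Submodule.ideal_span_singleton_smul] at hs
    obtain ⟨l, -, rfl⟩ := hs
    have ht' : (t : F) ∈ J • (⊤ : Submodule R F) := by
      have := Submodule.mem_map_of_mem (f := (LinearMap.ker g).subtype) ht
      rw [Submodule.map_smul''] at this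
      exact Submodule.smul_mono le_rfl le_top this
    have hyl : y - l ∈ n • (⊤ : Submodule R F) := by
      refine Module.Flat.mem_smul_top_of_smul_mem hann (e := e) ?_
      have : e • (y - (l : F)) = t := by
        have := congrArg Subtype.val hst
        simp only [Submodule.coe_add] at this
        rw [smul_sub, sub_eq_iff_eq_add', ← this]
        rfl
      rwa [this]
    have := Submodule.mem_map_of_mem (f := g) hyl
    rw [Submodule.map_smul'', map_sub, LinearMap.mem_ker.1 l.2, sub_zero] at this
    exact Submodule.smul_mono le_rfl le_top this

theorem weakGlobalDim_eq_top {e : R} {J n : Ideal R}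
    (hen : e ∈ n) (hne : ∀ a ∈ n, a * e = 0) (hn : n ≤ Ideal.span {e} ⊔ J)
    (hann : ∀ a, a * e ∈ J → a ∈ n) (htop : n ≠ ⊤) : weakGlobalDim R = ⊤ := by
  refine top_le_iff.1 (le_iSup_of_le (ModuleCat.of R (R ⧸ n)) ?_)
  refine le_iInf₂ fun d hd ↦ ?_
  exfalso
  have h := HasFlatDimLE.mem_smul_top_of_smul_eq_zero.{u, u} hen hne hn hann d (R ⧸ n) hd
    (Ideal.Quotient.mk n 1) (by
      rw [← Ideal.Quotient.mk_eq_mk, ← Submodule.Quotient.mk_smul]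
      exact (Submodule.Quotient.mk_eq_zero n).2 (by simpa using hen))
  have hz : n • (⊤ : Submodule R (R ⧸ n)) = ⊥ := by
    rw [eq_bot_iff, Submodule.smul_le]
    rintro a ha ⟨b⟩ -
    exact (Submodule.Quotient.mk_eq_zero n).2 (n.mul_mem_right b ha)
  rw [hz, Submodule.mem_bot, Ideal.Quotient.eq_zero_iff_mem] at h
  exact htop ((Ideal.eq_top_iff_one n).2 h)

end FlatDimension

theorem Ideal.eq_zero_of_free_of_mul_eq_zero {R : Type*} [CommRing R] {I : Ideal R}
    [Module.Free R I] (hI : I ≠ ⊥) {e : R} (he : ∀ x ∈ I, x * e = 0) : e = 0 := by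
  have : Nontrivial I := Submodule.nontrivial_iff_ne_bot.2 hI
  have : FaithfulSMul R I := Module.Free.instFaithfulSMulOfNontrivial R I
  refine this.eq_of_smul_eq_smul fun x ↦ Subtype.ext ?_
  rw [zero_smul, Submodule.coe_smul, smul_eq_mul, mul_comm, he x x.2, Submodule.coe_zero]

namespace ResidueTrivialExt

open IsLocalRing TrivSqZeroExt

variable (A : Type u) [CommRing A] [IsLocalRing A] (ι : Type w)

instance : IsLocalRing (ResidueTrivialExt A ι) :=
  .of_isUnit_or_isUnit_one_sub_self fun a ↦ by
    simp only [isUnit_iff_isUnit_fst]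
    simpa using isUnit_or_isUnit_one_sub_self a.fst

variable {A ι}

theorem mem_maximalIdeal_iff {x : ResidueTrivialExt A ι} :
    x ∈ maximalIdeal (ResidueTrivialExt A ι) ↔ x.fst ∈ maximalIdeal A := by
  simp only [mem_maximalIdeal, mem_nonunits_iff, isUnit_iff_isUnit_fst]

theorem smul_eq_zero_of_mem {a : A} (ha : a ∈ maximalIdeal A)
    (v : ι →₀ A ⧸ maximalIdeal A) : a • v = 0 := by
  ext i
  obtain ⟨b, hb⟩ := Ideal.Quotient.mk_surjective (v i)
  rw [Finsupp.smul_apply, ← hb]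
  exact (Submodule.Quotient.mk_eq_zero _).2 (Ideal.mul_mem_right b _ ha)

theorem snd_mul_of_mem {r x : ResidueTrivialExt A ι}
    (hx : x ∈ maximalIdeal (ResidueTrivialExt A ι)) : (r * x).snd = r.fst • x.snd := by
  rw [snd_mul, op_smul_eq_smul, smul_eq_zero_of_mem (mem_maximalIdeal_iff.1 hx), add_zero]

/-- The elements of the maximal ideal whose second component is supported in `s`. -/
def supportedIdeal (A : Type u) [CommRing A] [IsLocalRing A] {ι : Type w} (s : Set ι) :
    Ideal (ResidueTrivialExt A ι) where
  carrier := {x | x ∈ maximalIdeal (ResidueTrivialExt A ι) ∧ ∀ i ∉ s, x.snd i = 0}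
  add_mem' := fun {a b} ha hb ↦
    ⟨add_mem ha.1 hb.1, fun i hi ↦ by simp [ha.2 i hi, hb.2 i hi]⟩
  zero_mem' := ⟨zero_mem _, by simp⟩
  smul_mem' := fun r x hx ↦ ⟨Ideal.mul_mem_left _ r hx.1, fun i hi ↦ by
    rw [smul_eq_mul, snd_mul_of_mem hx.1, Finsupp.smul_apply, hx.2 i hi, smul_zero]⟩

theorem mem_supportedIdeal {s : Set ι} {x : ResidueTrivialExt A ι} :
    x ∈ supportedIdeal A s ↔
      x ∈ maximalIdeal (ResidueTrivialExt A ι) ∧ ∀ i ∉ s, x.snd i = 0 := Iff.rfl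

theorem inr_mem_maximalIdeal (v : ι →₀ A ⧸ maximalIdeal A) :
    (inr v : ResidueTrivialExt A ι) ∈ maximalIdeal (ResidueTrivialExt A ι) :=
  mem_maximalIdeal_iff.2 (by simp)

theorem mul_inr_of_mem {x : ResidueTrivialExt A ι}
    (hx : x ∈ maximalIdeal (ResidueTrivialExt A ι)) (v : ι →₀ A ⧸ maximalIdeal A) :
    x * inr v = 0 := by
  ext1
  · simp
  · rw [snd_mul_of_mem (inr_mem_maximalIdeal v), snd_inr,
      smul_eq_zero_of_mem (mem_maximalIdeal_iff.1 hx), snd_zero]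

theorem exists_le_supportedIdeal {J : Ideal (ResidueTrivialExt A ι)} (hJ : J.FG)
    (hle : J ≤ maximalIdeal (ResidueTrivialExt A ι)) :
    ∃ s : Finset ι, J ≤ supportedIdeal A (s : Set ι) := by
  classical
  obtain ⟨t, rfl⟩ := hJ
  refine ⟨t.biUnion fun x ↦ x.snd.support, Submodule.span_le.2 fun x hx ↦
    ⟨hle (Submodule.subset_span hx), fun i hi ↦ ?_⟩⟩
  by_contra h
  exact hi (Finset.mem_coe.2 (Finset.mem_biUnion.2 ⟨x, hx, Finsupp.mem_support_iff.2 h⟩))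

theorem mem_kerIdeal_mul_eq_zero {e : ResidueTrivialExt A ι}
    (he : e ∈ kerIdeal A (ι →₀ A ⧸ maximalIdeal A)) {x : ResidueTrivialExt A ι}
    (hx : x ∈ maximalIdeal (ResidueTrivialExt A ι)) : e * x = 0 := by
  rw [mem_kerIdeal_iff_inr] at he
  rw [he, mul_comm, mul_inr_of_mem hx]

/-- Finitely many generators in the maximal ideal involve only finitely many coordinates, and
multiplying by ring elements adds none. -/
theorem not_kerIdeal_le [Infinite ι] {J : Ideal (ResidueTrivialExt A ι)} (hJ : J.FG)
    (hle : J ≤ maximalIdeal (ResidueTrivialExt A ι)) :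
    ¬ kerIdeal A (ι →₀ A ⧸ maximalIdeal A) ≤ J := by
  intro h
  obtain ⟨s, hs⟩ := exists_le_supportedIdeal hJ hle
  obtain ⟨i, hi⟩ := Infinite.exists_notMem_finset s
  have := (hs (h ((mem_kerIdeal_iff_inr _ _ _).2 rfl :
    inr (Finsupp.single i (1 : A ⧸ maximalIdeal A)) ∈ _))).2 i (by simpa using hi)
  simp at this

theorem weakGlobalDim_eq_top [Nonempty ι] : weakGlobalDim (ResidueTrivialExt A ι) = ⊤ := by
  obtain ⟨i⟩ := ‹Nonempty ι›
  set e : ResidueTrivialExt A ι := inr (Finsupp.single i (1 : A ⧸ maximalIdeal A))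
  refine _root_.weakGlobalDim_eq_top (e := e) (J := supportedIdeal A {i}ᶜ)
    (n := maximalIdeal (ResidueTrivialExt A ι)) (inr_mem_maximalIdeal _)
    (fun a ha ↦ mul_inr_of_mem ha _) (fun x hx ↦ ?_) (fun a ha ↦ ?_) (maximalIdeal.isMaximal _).ne_top
  · obtain ⟨b, hb⟩ := Ideal.Quotient.mk_surjective (x.snd i)
    rw [Submodule.mem_sup]
    -- Subtracting `b e`, where `b` lifts the `i`-th coordinate of `x`, clears that coordinate.
    refine ⟨inl b * e, Ideal.mul_mem_left _ _ (Ideal.mem_span_singleton_self e),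
      x - inl b * e, ⟨sub_mem hx (Ideal.mul_mem_left _ _ (inr_mem_maximalIdeal _)), ?_⟩, by ring⟩
    intro j hj
    obtain rfl : j = i := by simpa using hj
    rw [snd_sub, snd_mul_of_mem (inr_mem_maximalIdeal _), Finsupp.sub_apply, ← hb]
    simp [Algebra.smul_def]
  · have := ha.2 i (by simp)
    rw [snd_mul_of_mem (inr_mem_maximalIdeal _)] at this
    rw [mem_maximalIdeal_iff, ← Ideal.Quotient.eq_zero_iff_mem]
    simpa [Algebra.smul_def] using this

theorem free_of_isStronglyGorensteinProjective [Infinite ι] (M : Type v) [AddCommGroup M]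
    [Module (ResidueTrivialExt A ι) M] [Module.Finite (ResidueTrivialExt A ι) M]
    (hM : IsStronglyGorensteinProjective (ResidueTrivialExt A ι) M) :
    Module.Free (ResidueTrivialExt A ι) M := by
  obtain ⟨P, _, _, f, hf, ⟨φ⟩⟩ := hM
  have := hf.projective
  have := Module.Finite.equiv φ
  have := Module.Free.range_of_exact_self (kerIdeal A (ι →₀ A ⧸ maximalIdeal A))
    (fun e he x hx ↦ mem_kerIdeal_mul_eq_zero he hx) (fun J hJ hle ↦ not_kerIdeal_le hJ hle)
    f hf.exact
  exact Module.Free.of_equiv φ.symm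

theorem eq_bot_of_free [Nonempty ι] {I : Ideal (ResidueTrivialExt A ι)}
    [Module.Free (ResidueTrivialExt A ι) I] (hI : I ≠ ⊤) : I = ⊥ := by
  obtain ⟨i⟩ := ‹Nonempty ι›
  by_contra hne
  have h := Ideal.eq_zero_of_free_of_mul_eq_zero hne fun x hx ↦
    mul_inr_of_mem (le_maximalIdeal hI hx) (Finsupp.single i (1 : A ⧸ maximalIdeal A))
  simpa using congrArg (fun z : ResidueTrivialExt A ι ↦ z.snd i) h

end ResidueTrivialExt

theorem corollary3p3 (A : Type u) [CommRing A] [IsLocalRing A]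
    (hm : (IsLocalRing.maximalIdeal A).FG) (ι : Type w) [Infinite ι] :
    weakGlobalDim (ResidueTrivialExt A ι) = ⊤ ∧
    (∀ (M : Type v) [AddCommGroup M] [Module (ResidueTrivialExt A ι) M],
      Module.Finite (ResidueTrivialExt A ι) M →
      IsStronglyGorensteinProjective (ResidueTrivialExt A ι) M →
      Module.Projective (ResidueTrivialExt A ι) M) ∧
    (∀ I : Ideal (ResidueTrivialExt A ι), I.FG → I ≠ ⊥ → I ≠ ⊤ →
      ¬ IsStronglyGorensteinProjective (ResidueTrivialExt A ι) I) := by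
  refine ⟨ResidueTrivialExt.weakGlobalDim_eq_top, fun M _ _ _ hM ↦ ?_, fun I hI hbot htop h ↦ ?_⟩
  · have := ResidueTrivialExt.free_of_isStronglyGorensteinProjective M hM
    infer_instance
  · have := Module.Finite.iff_fg.2 hI
    have := ResidueTrivialExt.free_of_isStronglyGorensteinProjective I h
    exact hbot (ResidueTrivialExt.eq_bot_of_free htop)
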